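/- Let $m\ge 1$ and let $W:\mathbb{R}^m\to\mathbb{R}$ be a nonnegative $C^4$ function whose zero set $A$ is finite and has at least two elements, so that $0=W(a)<W(u)$ for $a\in A$, $u\in\mathbb{R}^m\setminus A$. Write $W_u$ and $W_{uu}$ for the gradient and the Hessian matrix of $W$. Let $a\in A$ be such that $W_{uu}(a)$ has $m$ distinct positive eigenvalues. Let $\bar u:(0,+\infty)\to\mathbb{R}^m$ be a solution of $u''=W_u(u)$, not identically equal to $a$, with $\lim_{s\to+\infty}\bar u(s)=a$. Then the limit \[\lim_{s\to+\infty}\frac{\bar u(s)-a}{|\bar u(s)-a|}=z\] exists and $z$ is an eigenvector of $W_{uu}(a)$. Moreover, if $\mu^2$, $\mu>0$, denotes the eigenvalue of $W_{uu}(a)$ associated with $z$, there are constants $\bar K>0$ and $\mu^+>\mu$ and a map $w:(0,+\infty)\to\mathbb{R}^m$, which is of class $C^5$ (and of class $C^{n+1}$ whenever $W$ is of class $C^n$), such that \[\bar u(s)-a=\bar K z e^{-\mu s}+w(s),\quad s>0,\] and such that for every $s_0>0$ there is $K^+>0$ with \[|w(s)|,\ |D^kw(s)|\le K^+e^{-\mu^+s},\quad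 s\ge s_0,\ k=1,2,3.\] If, in addition, $\bar u$ is bounded on $(0,+\infty)$, then there is $K^+>0$ such that these bounds hold for all $s>0$. The analogous statement holds at $-\infty$: if $\bar u:(-\infty,0)\to\mathbb{R}^m$ is a solution of $u''=W_u(u)$, not identically equal to $a$, with $\lim_{s\to-\infty}\bar u(s)=a$, then $\frac{\bar u(s)-a}{|\bar u(s)-a|}$ converges, as $s\to-\infty$, to an eigenvector $z$ of $W_{uu}(a)$, with eigenvalue $\mu^2$, $\mu>0$, and there are constants $\bar K>0$, $\mu^+>\mu$ and a map $w:(-\infty,0)\to\mathbb{R}^m$ of class $C^5$ (and $C^{n+1}$ whenever $W$ is $C^n$) such that $\bar u(s)-a=\bar K z e^{\mu s}+w(s)$ for $s<0$ and, for every $s_0<0$, there is $K^+>0$ with $|w(s)|,|D^kw(s)|\le K^+e^{\mu^+s}$ for $s\le s_0$, $k=1,2,3$; if $\bar u$ is bounded on $(-\infty,0)$, then there is $K^+>0$ such that these bounds hold for all $s<0$. -/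

import Mathlib

open Set Filter Topology

noncomputable section

/-- The Hessian `W_uu(a)` as a linear operator on `ℝᵐ`: the derivative at `a` of the gradient `W_u`.
In the standard basis its matrix is the matrix of second partial derivatives of `W` at `a`. -/
def hessianAt {m : ℕ} (W : EuclideanSpace ℝ (Fin m) → ℝ) (a : EuclideanSpace ℝ (Fin m)) :
    EuclideanSpace ℝ (Fin m) →L[ℝ] EuclideanSpace ℝ (Fin m) :=
  fderiv ℝ (gradient W) a

/-- The Hessian of `W` at `a` has `m` distinct positive eigenvalues. There are as many of them as
the dimension, so they are all the eigenvalues. -/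
def HasDistinctPosEigenvalues {m : ℕ} (W : EuclideanSpace ℝ (Fin m) → ℝ)
    (a : EuclideanSpace ℝ (Fin m)) : Prop :=
  ∃ ev : Fin m → ℝ, Function.Injective ev ∧
    ∀ i, 0 < ev i ∧ Module.End.HasEigenvalue (hessianAt W a).toLinearMap (ev i)

/-- `u` is a (classical) solution of `u'' = W_u(u)` on the open set `S ⊆ ℝ`. Only the values of
`u` on `S` matter. -/
def IsNewtonSolutionOn {m : ℕ} (W : EuclideanSpace ℝ (Fin m) → ℝ)
    (u : ℝ → EuclideanSpace ℝ (Fin m)) (S : Set ℝ) : Prop :=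
  ∀ s ∈ S, DifferentiableAt ℝ u s ∧ HasDerivAt (deriv u) (gradient W (u s)) s

end

/-! Put `v = u - a` and `H = W_uu(a)`. Since `a` minimizes `W`, Taylor's formula gives `v'' = H v +
g` with `g = O(|v|²)`, and an eigenbasis of `H` splits this into scalar equations `f'' = κ² f + g`.
Factor the operator as `(d/ds - κ)(d/ds + κ)`: boundedness excludes the growing mode, which leaves
`f = K e^{-κs}` up to an error with the decay rate of `g` (`exists_expansion_of_deriv2_eq`).

A convexity estimate for the sum of squared coordinates shows that `v` decays exponentially. The
supremum `σ` of its decay rates is finite: otherwise `v` vanishes near infinity, hence everywhere by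
backward uniqueness. Since `g` decays at nearly the rate `2σ`, the scalar expansions hold with an
error of some rate `ρ > σ`. Not all `K` vanish, or `v` would decay faster than `σ` allows. The
smallest frequency with `K ≠ 0` gives the leading term, and simplicity of the spectrum makes its
direction unique (`exists_leading_exp_term`).

For the remainder, the equation controls the second derivative, interpolation the first, and the
differentiated equation the third (`newtonDeriv_sub_isBigO`). Reflecting time gives the statement at
`-∞`. -/

/-! ### Scalar differential equations and inequalities -/

/-- A function whose derivative is bounded by a decaying exponential has a limit at `+∞`, which it
approaches at the same exponential rate. -/
lemma exists_abs_sub_le_of_abs_deriv_le_exp {F F' : ℝ → ℝ} {S c δ : ℝ} (hδ : 0 < δ)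
    (hF : ∀ s, S ≤ s → HasDerivAt F (F' s) s)
    (hF' : ∀ s, S ≤ s → |F' s| ≤ c * Real.exp (-δ * s)) :
    ∃ l, ∀ s, S ≤ s → |F s - l| ≤ c / δ * Real.exp (-δ * s) := by
  have hexp : ∀ s, HasDerivAt (fun s => c / δ * Real.exp (-δ * s)) (-(c * Real.exp (-δ * s))) s := by
    intro s
    have := (((hasDerivAt_id s).const_mul (-δ)).exp).const_mul (c / δ)
    refine this.congr_deriv ?_
    simp only [id]
    field_simp
  have hc : 0 ≤ c := by
    have := (abs_nonneg _).trans (hF' S le_rfl)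
    exact nonneg_of_mul_nonneg_left this (Real.exp_pos _)
  -- Shifting `F` by the primitive of the bound gives an increasing lower and a decreasing upper
  -- barrier; the limit is the supremum of the lower one.
  have hG : MonotoneOn (fun s => F s - c / δ * Real.exp (-δ * s)) (Ici S) := by
    refine monotoneOn_of_hasDerivWithinAt_nonneg (convex_Ici S)
      (fun s hs => ((hF s hs).sub (hexp s)).continuousAt.continuousWithinAt)
      (fun s hs => ((hF s (interior_subset hs)).sub (hexp s)).hasDerivWithinAt) ?_
    intro s hs
    have := neg_abs_le (F' s)
    have := hF' s (interior_subset hs)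
    linarith
  have hH : AntitoneOn (fun s => F s + c / δ * Real.exp (-δ * s)) (Ici S) := by
    refine antitoneOn_of_hasDerivWithinAt_nonpos (convex_Ici S)
      (fun s hs => ((hF s hs).add (hexp s)).continuousAt.continuousWithinAt)
      (fun s hs => ((hF s (interior_subset hs)).add (hexp s)).hasDerivWithinAt) ?_
    intro s hs
    have := le_abs_self (F' s)
    have := hF' s (interior_subset hs)
    linarith
  have hle : ∀ t, S ≤ t → ∀ s, S ≤ s →
      F t - c / δ * Real.exp (-δ * t) ≤ F s + c / δ * Real.exp (-δ * s) := by
    intro t ht s hs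
    have h1 : ∀ r, 0 ≤ c / δ * Real.exp (-δ * r) := fun r => by positivity
    rcases le_total t s with h | h
    · have := hG ht hs h
      simp only at this
      linarith [h1 s]
    · have := hH hs ht h
      simp only at this
      linarith [h1 t]
  have hne : ((fun s => F s - c / δ * Real.exp (-δ * s)) '' Ici S).Nonempty :=
    ⟨_, S, self_mem_Ici, rfl⟩
  refine ⟨sSup ((fun s => F s - c / δ * Real.exp (-δ * s)) '' Ici S), fun s hs => ?_⟩
  have h1 : F s - c / δ * Real.exp (-δ * s)
      ≤ sSup ((fun s => F s - c / δ * Real.exp (-δ * s)) '' Ici S) := by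
    refine le_csSup ⟨F s + c / δ * Real.exp (-δ * s), ?_⟩ ⟨s, hs, rfl⟩
    rintro _ ⟨t, ht, rfl⟩
    exact hle t ht s hs
  have h2 : sSup ((fun s => F s - c / δ * Real.exp (-δ * s)) '' Ici S)
      ≤ F s + c / δ * Real.exp (-δ * s) := by
    refine csSup_le hne ?_
    rintro _ ⟨t, ht, rfl⟩
    exact hle t ht s hs
  rw [abs_le]
  constructor <;> linarith

/-- A function whose derivative is bounded by a growing exponential grows at most at that rate. -/
lemma abs_le_of_abs_deriv_le_exp {F F' : ℝ → ℝ} {S c δ : ℝ} (hδ : 0 < δ)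
    (hF : ∀ s, S ≤ s → HasDerivAt F (F' s) s)
    (hF' : ∀ s, S ≤ s → |F' s| ≤ c * Real.exp (δ * s)) :
    ∀ s, S ≤ s → |F s| ≤ |F S| + c / δ * Real.exp (δ * s) := by
  intro s hs
  have hc : 0 ≤ c := by
    have := (abs_nonneg _).trans (hF' S le_rfl)
    exact nonneg_of_mul_nonneg_left this (Real.exp_pos _)
  have hexp : ∀ s, HasDerivAt (fun s => c / δ * Real.exp (δ * s)) (c * Real.exp (δ * s)) s := by
    intro s
    have := (((hasDerivAt_id s).const_mul δ).exp).const_mul (c / δ)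
    refine this.congr_deriv ?_
    simp only [id]
    field_simp
  have hG : MonotoneOn (fun s => F s + c / δ * Real.exp (δ * s)) (Ici S) := by
    refine monotoneOn_of_hasDerivWithinAt_nonneg (convex_Ici S)
      (fun s hs => ((hF s hs).add (hexp s)).continuousAt.continuousWithinAt)
      (fun s hs => ((hF s (interior_subset hs)).add (hexp s)).hasDerivWithinAt) ?_
    intro s hs
    have := neg_abs_le (F' s)
    have := hF' s (interior_subset hs)
    linarith
  have hH : AntitoneOn (fun s => F s - c / δ * Real.exp (δ * s)) (Ici S) := by
    refine antitoneOn_of_hasDerivWithinAt_nonpos (convex_Ici S)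
      (fun s hs => ((hF s hs).sub (hexp s)).continuousAt.continuousWithinAt)
      (fun s hs => ((hF s (interior_subset hs)).sub (hexp s)).hasDerivWithinAt) ?_
    intro s hs
    have := le_abs_self (F' s)
    have := hF' s (interior_subset hs)
    linarith
  have h1 := hG self_mem_Ici hs hs
  have h2 := hH self_mem_Ici hs hs
  simp only at h1 h2
  have h3 : 0 ≤ c / δ * Real.exp (δ * S) := by positivity
  have h4 := neg_abs_le (F S)
  have h5 := le_abs_self (F S)
  rw [abs_le]
  constructor <;> linarith

/-- Bounded solutions of `f'' = κ² f + g` with `g` exponentially small. -/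
lemma exists_expansion_of_deriv2_eq {f f' g : ℝ → ℝ} {κ ρ : ℝ} (hκ : 0 < κ) (hρ : 0 < ρ)
    (hne : ρ ≠ κ) (hf : ∀ᶠ s in atTop, HasDerivAt f (f' s) s)
    (hf' : ∀ᶠ s in atTop, HasDerivAt f' (κ ^ 2 * f s + g s) s)
    (hg : g =O[atTop] fun s => Real.exp (-ρ * s))
    (hfb : f =O[atTop] fun _ => (1 : ℝ)) (hfb' : f' =O[atTop] fun _ => (1 : ℝ)) :
    ∃ K : ℝ, (ρ < κ → K = 0) ∧
      (fun s => f s - K * Real.exp (-κ * s)) =O[atTop] fun s => Real.exp (-ρ * s) := by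
  obtain ⟨c, hc⟩ := hg.bound
  obtain ⟨S, hS⟩ := eventually_atTop.1 (hf.and (hf'.and hc))
  simp only [Real.norm_eq_abs, Real.abs_exp] at hS
  have hlin : ∀ k s : ℝ, HasDerivAt (fun s => Real.exp (k * s)) (k * Real.exp (k * s)) s := by
    intro k s
    have := ((hasDerivAt_id s).const_mul k).exp
    simpa [mul_comm] using this
  -- `p = f' + κ f` solves `p' = κ p + g`, so `e^{-κs} p` has derivative `e^{-κs} g`. Its limit `l`
  -- is the coefficient of the growing mode.
  obtain ⟨l, hl⟩ := exists_abs_sub_le_of_abs_deriv_le_exp (S := S) (c := c) (δ := κ + ρ)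
    (F := fun s => Real.exp (-κ * s) * (f' s + κ * f s)) (F' := fun s => Real.exp (-κ * s) * g s)
    (by positivity)
    (by
      intro s hs
      obtain ⟨h1, h2, -⟩ := hS s hs
      refine HasDerivAt.congr_deriv ((hlin (-κ) s).mul (h2.add (h1.const_mul κ))) ?_
      ring)
    (by
      intro s hs
      obtain ⟨-, -, h3⟩ := hS s hs
      rw [abs_mul, Real.abs_exp, show -(κ + ρ) * s = -κ * s + -ρ * s by ring, Real.exp_add]
      nlinarith [Real.exp_pos (-κ * s)])
  have htend : ∀ k : ℝ, 0 < k → Tendsto (fun s => Real.exp (-k * s)) atTop (𝓝 0) := by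
    intro k hk
    refine Real.tendsto_exp_atBot.comp ?_
    exact tendsto_id.const_mul_atTop_of_neg (by linarith)
  have hl0 : l = 0 := by
    have h1 : Tendsto (fun s => Real.exp (-κ * s) * (f' s + κ * f s)) atTop (𝓝 0) := by
      have h : (fun s => Real.exp (-κ * s) * (f' s + κ * f s)) =O[atTop]
          fun s => Real.exp (-κ * s) * 1 :=
        (Asymptotics.isBigO_refl _ _).mul (hfb'.add (hfb.const_mul_left κ))
      refine h.trans_tendsto ?_
      simpa using htend κ hκ
    have h2 : Tendsto (fun s => Real.exp (-κ * s) * (f' s + κ * f s)) atTop (𝓝 l) := by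
      rw [tendsto_iff_norm_sub_tendsto_zero]
      have h3 := (htend (κ + ρ) (by positivity)).const_mul (c / (κ + ρ))
      rw [mul_zero] at h3
      exact squeeze_zero' (Eventually.of_forall fun _ => norm_nonneg _)
        (eventually_atTop.2 ⟨S, fun s hs => hl s hs⟩) h3
    exact tendsto_nhds_unique h2 h1
  subst hl0
  have hp : ∀ s, S ≤ s → |f' s + κ * f s| ≤ c / (κ + ρ) * Real.exp (-ρ * s) := by
    intro s hs
    have h1 := hl s hs
    rw [sub_zero, abs_mul, Real.abs_exp, show -(κ + ρ) * s = -κ * s + -ρ * s by ring,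
      Real.exp_add] at h1
    refine le_of_mul_le_mul_left ?_ (Real.exp_pos (-κ * s))
    linarith
  have hder : ∀ s, S ≤ s → HasDerivAt (fun s => Real.exp (κ * s) * f s)
      (Real.exp (κ * s) * (f' s + κ * f s)) s := by
    intro s hs
    refine HasDerivAt.congr_deriv ((hlin κ s).mul (hS s hs).1) ?_
    ring
  have hmul : ∀ s, Real.exp (-κ * s) * Real.exp (κ * s) = 1 := by
    intro s
    rw [← Real.exp_add, ← Real.exp_zero]
    congr 1
    ring
  -- The derivative of `e^{κs} f` is `O(e^{(κ-ρ)s})`. For `ρ < κ` this only bounds its growth; for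
  -- `ρ > κ` it is integrable and the limit is `K`.
  rcases lt_or_gt_of_ne hne with hlt | hlt
  · refine ⟨0, fun _ => rfl, ?_⟩
    have h1 := abs_le_of_abs_deriv_le_exp (S := S) (c := c / (κ + ρ)) (δ := κ - ρ)
      (by linarith) hder (by
        intro s hs
        rw [abs_mul, Real.abs_exp, show (κ - ρ) * s = κ * s + -ρ * s by ring, Real.exp_add]
        nlinarith [Real.exp_pos (κ * s), hp s hs])
    refine Asymptotics.IsBigO.of_bound
      (|Real.exp (κ * S) * f S| + c / (κ + ρ) / (κ - ρ)) ?_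
    filter_upwards [eventually_ge_atTop S, eventually_ge_atTop 0] with s hs hs0
    have h2 := h1 s hs
    rw [abs_mul, Real.abs_exp] at h2
    rw [zero_mul, sub_zero, Real.norm_eq_abs, Real.norm_eq_abs, Real.abs_exp]
    have h3 : Real.exp (-κ * s) ≤ Real.exp (-ρ * s) := by
      apply Real.exp_le_exp.2
      nlinarith
    have h4 : Real.exp (-κ * s) * Real.exp ((κ - ρ) * s) = Real.exp (-ρ * s) := by
      rw [← Real.exp_add]
      congr 1
      ring
    calc |f s| = Real.exp (-κ * s) * (Real.exp (κ * s) * |f s|) := by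
          rw [← mul_assoc, hmul, one_mul]
      _ ≤ Real.exp (-κ * s) * (|Real.exp (κ * S) * f S| +
          c / (κ + ρ) / (κ - ρ) * Real.exp ((κ - ρ) * s)) := by
          gcongr
      _ = Real.exp (-κ * s) * |Real.exp (κ * S) * f S| +
          c / (κ + ρ) / (κ - ρ) * Real.exp (-ρ * s) := by rw [← h4]; ring
      _ ≤ _ := by
          rw [add_mul, mul_comm (Real.exp (-κ * s))]
          gcongr
  · obtain ⟨K, hK⟩ := exists_abs_sub_le_of_abs_deriv_le_exp (S := S) (c := c / (κ + ρ))
      (δ := ρ - κ) (by linarith) hder (by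
        intro s hs
        rw [abs_mul, Real.abs_exp, show -(ρ - κ) * s = κ * s + -ρ * s by ring, Real.exp_add]
        nlinarith [Real.exp_pos (κ * s), hp s hs])
    refine ⟨K, fun h => absurd h (by linarith), ?_⟩
    refine Asymptotics.IsBigO.of_bound (c / (κ + ρ) / (ρ - κ)) ?_
    filter_upwards [eventually_ge_atTop S] with s hs
    have h2 := hK s hs
    rw [Real.norm_eq_abs, Real.norm_eq_abs, Real.abs_exp]
    have h4 : Real.exp (-κ * s) * Real.exp (-(ρ - κ) * s) = Real.exp (-ρ * s) := by
      rw [← Real.exp_add]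
      congr 1
      ring
    have h5 : f s - K * Real.exp (-κ * s) =
        Real.exp (-κ * s) * (Real.exp (κ * s) * f s - K) := by
      rw [mul_sub, ← mul_assoc, hmul]
      ring
    rw [h5, abs_mul, Real.abs_exp, ← h4]
    have := Real.exp_pos (-κ * s)
    nlinarith

/-- A bounded function with `φ'' ≥ c² φ` decays exponentially. -/
lemma exists_le_exp_of_deriv2_ge {φ φ' φ'' : ℝ → ℝ} {c : ℝ} (hc : 0 < c)
    (h1 : ∀ᶠ s in atTop, HasDerivAt φ (φ' s) s) (h2 : ∀ᶠ s in atTop, HasDerivAt φ' (φ'' s) s)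
    (hge : ∀ᶠ s in atTop, c ^ 2 * φ s ≤ φ'' s)
    (hφ : φ =O[atTop] fun _ => (1 : ℝ)) (hφ' : φ' =O[atTop] fun _ => (1 : ℝ)) :
    ∃ C, ∀ᶠ s in atTop, φ s ≤ C * Real.exp (-c * s) := by
  obtain ⟨S, hS⟩ := eventually_atTop.1 (h1.and (h2.and hge))
  have hlin : ∀ k s : ℝ, HasDerivAt (fun s => Real.exp (k * s)) (k * Real.exp (k * s)) s := by
    intro k s
    have := ((hasDerivAt_id s).const_mul k).exp
    simpa [mul_comm] using this
  -- The same factorization with an inequality: `e^{-c s}(φ' + c φ)` increases to `0`, so `φ' + c φ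
  -- ≤ 0` and `e^{c s} φ` decreases.
  have hd1 : ∀ s, S ≤ s → HasDerivAt (fun s => Real.exp (-c * s) * (φ' s + c * φ s))
      (Real.exp (-c * s) * (φ'' s - c ^ 2 * φ s)) s := by
    intro s hs
    obtain ⟨h1, h2, -⟩ := hS s hs
    refine HasDerivAt.congr_deriv ((hlin (-c) s).mul (h2.add (h1.const_mul c))) ?_
    ring
  have hmono : MonotoneOn (fun s => Real.exp (-c * s) * (φ' s + c * φ s)) (Ici S) := by
    refine monotoneOn_of_hasDerivWithinAt_nonneg (convex_Ici S)
      (fun s hs => (hd1 s hs).continuousAt.continuousWithinAt)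
      (fun s hs => (hd1 s (interior_subset hs)).hasDerivWithinAt) ?_
    intro s hs
    have := (hS s (interior_subset hs)).2.2
    exact mul_nonneg (Real.exp_pos _).le (by linarith)
  have htend : Tendsto (fun s => Real.exp (-c * s) * (φ' s + c * φ s)) atTop (𝓝 0) := by
    have h : (fun s => Real.exp (-c * s) * (φ' s + c * φ s)) =O[atTop]
        fun s => Real.exp (-c * s) * 1 :=
      (Asymptotics.isBigO_refl _ _).mul (hφ'.add (hφ.const_mul_left c))
    refine h.trans_tendsto ?_
    simp only [mul_one]
    exact Real.tendsto_exp_atBot.comp (tendsto_id.const_mul_atTop_of_neg (by linarith))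
  have hp : ∀ s, S ≤ s → φ' s + c * φ s ≤ 0 := by
    intro s hs
    have : Real.exp (-c * s) * (φ' s + c * φ s) ≤ 0 :=
      ge_of_tendsto htend (eventually_atTop.2 ⟨s, fun t ht => hmono hs (hs.trans ht) ht⟩)
    exact nonpos_of_mul_nonpos_right this (Real.exp_pos _)
  have hd2 : ∀ s, S ≤ s → HasDerivAt (fun s => Real.exp (c * s) * φ s)
      (Real.exp (c * s) * (φ' s + c * φ s)) s := by
    intro s hs
    refine HasDerivAt.congr_deriv ((hlin c s).mul (hS s hs).1) ?_
    ring
  have hanti : AntitoneOn (fun s => Real.exp (c * s) * φ s) (Ici S) := by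
    refine antitoneOn_of_hasDerivWithinAt_nonpos (convex_Ici S)
      (fun s hs => (hd2 s hs).continuousAt.continuousWithinAt)
      (fun s hs => (hd2 s (interior_subset hs)).hasDerivWithinAt) ?_
    intro s hs
    exact mul_nonpos_of_nonneg_of_nonpos (Real.exp_pos _).le (hp s (interior_subset hs))
  refine ⟨Real.exp (c * S) * φ S, eventually_atTop.2 ⟨S, fun s hs => ?_⟩⟩
  have h3 := hanti self_mem_Ici hs hs
  simp only at h3
  have h4 : Real.exp (-c * s) * Real.exp (c * s) = 1 := by
    rw [← Real.exp_add, ← Real.exp_zero]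
    congr 1
    ring
  calc φ s = (Real.exp (c * s) * φ s) * Real.exp (-c * s) := by
        rw [mul_comm, ← mul_assoc, h4, one_mul]
    _ ≤ _ := by gcongr

/-- Landau-type interpolation on a unit interval. -/
lemma norm_deriv_le_of_norm_le_of_norm_deriv2_le {E : Type*} [NormedAddCommGroup E]
    [NormedSpace ℝ E] {v v' v'' : ℝ → E} {s ε : ℝ}
    (h1 : ∀ t ∈ Icc s (s + 1), HasDerivAt v (v' t) t)
    (h2 : ∀ t ∈ Icc s (s + 1), HasDerivAt v' (v'' t) t)
    (hv : ∀ t ∈ Icc s (s + 1), ‖v t‖ ≤ ε) (hv'' : ∀ t ∈ Icc s (s + 1), ‖v'' t‖ ≤ ε) :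
    ‖v' s‖ ≤ 3 * ε := by
  have hs : s ∈ Icc s (s + 1) := ⟨le_rfl, by linarith⟩
  have hs1 : s + 1 ∈ Icc s (s + 1) := ⟨by linarith, le_rfl⟩
  have hε : 0 ≤ ε := (norm_nonneg _).trans (hv s hs)
  have h3 : ∀ t ∈ Icc s (s + 1), ‖v' t - v' s‖ ≤ ε := by
    intro t ht
    have := norm_image_sub_le_of_norm_deriv_le_segment' (f := v') (f' := v'') (C := ε)
      (fun x hx => (h2 x hx).hasDerivWithinAt) (fun x hx => hv'' x ⟨hx.1, hx.2.le⟩) t ht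
    have h4 : t - s ≤ 1 := by linarith [ht.2]
    nlinarith
  -- Subtracting the tangent line at `s` leaves a function whose derivative is at most `ε`.
  have h4 := norm_image_sub_le_of_norm_deriv_le_segment' (f := fun t => v t - (t - s) • v' s)
    (f' := fun t => v' t - v' s) (C := ε)
    (fun x hx => by
      refine (HasDerivAt.congr_deriv
        ((h1 x hx).sub (((hasDerivAt_id x).sub_const s).smul_const (v' s))) ?_).hasDerivWithinAt
      simp)
    (fun x hx => h3 x ⟨hx.1, hx.2.le⟩) (s + 1) hs1
  simp only [add_sub_cancel_left, one_smul, sub_self, zero_smul, sub_zero, mul_one] at h4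
  calc ‖v' s‖ = ‖v (s + 1) - v s - (v (s + 1) - v' s - v s)‖ := by congr 1; abel
    _ ≤ ‖v (s + 1)‖ + ‖v s‖ + ‖v (s + 1) - v' s - v s‖ :=
        (norm_sub_le _ _).trans (by gcongr; exact norm_sub_le _ _)
    _ ≤ 3 * ε := by linarith [hv _ hs, hv _ hs1]

lemma isBigO_exp_neg_mul {k l : ℝ} (h : k ≤ l) :
    (fun s : ℝ => Real.exp (-l * s)) =O[atTop] fun s => Real.exp (-k * s) := by
  refine Asymptotics.IsBigO.of_bound 1 ?_
  filter_upwards [eventually_ge_atTop 0] with s hs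
  rw [Real.norm_eq_abs, Real.norm_eq_abs, Real.abs_exp, Real.abs_exp, one_mul]
  exact Real.exp_le_exp.2 (by nlinarith)

lemma tendsto_exp_neg_mul_atTop {k : ℝ} (hk : 0 < k) :
    Tendsto (fun s : ℝ => Real.exp (-k * s)) atTop (𝓝 0) :=
  Real.tendsto_exp_atBot.comp (tendsto_id.const_mul_atTop_of_neg (by linarith))

/-! ### Decay rates and the leading exponential term -/

section

variable {E : Type*} [NormedAddCommGroup E] [NormedSpace ℝ E]

/-- Interpolation on `[s, s + 1]`, where the weight is largest at `s` because `ρ ≥ 0`. -/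
lemma isBigO_exp_deriv {v v' v'' : ℝ → E} {ρ : ℝ} (hρ : 0 ≤ ρ)
    (h1 : ∀ᶠ s in atTop, HasDerivAt v (v' s) s) (h2 : ∀ᶠ s in atTop, HasDerivAt v' (v'' s) s)
    (hv : v =O[atTop] fun s => Real.exp (-ρ * s))
    (hv'' : v'' =O[atTop] fun s => Real.exp (-ρ * s)) :
    v' =O[atTop] fun s => Real.exp (-ρ * s) := by
  obtain ⟨c, hc⟩ := hv.bound
  obtain ⟨d, hd⟩ := hv''.bound
  obtain ⟨S, hS⟩ := eventually_atTop.1 (h1.and (h2.and (hc.and hd)))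
  refine Asymptotics.IsBigO.of_bound (3 * (|c| + |d|)) ?_
  filter_upwards [eventually_ge_atTop S] with s hs
  simp only [Real.norm_eq_abs, Real.abs_exp] at hS ⊢
  have hexp : ∀ t ∈ Icc s (s + 1), Real.exp (-ρ * t) ≤ Real.exp (-ρ * s) := fun t ht =>
    Real.exp_le_exp.2 (by nlinarith [ht.1])
  rw [mul_assoc]
  refine norm_deriv_le_of_norm_le_of_norm_deriv2_le (fun t ht => (hS t (hs.trans ht.1)).1)
    (fun t ht => (hS t (hs.trans ht.1)).2.1) (fun t ht => ?_) (fun t ht => ?_)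
  · refine (hS t (hs.trans ht.1)).2.2.1.trans ?_
    have := le_abs_self c
    gcongr ?_ * ?_
    · linarith [abs_nonneg d]
    · exact hexp t ht
  · refine (hS t (hs.trans ht.1)).2.2.2.trans ?_
    have := le_abs_self d
    gcongr ?_ * ?_
    · linarith [abs_nonneg c]
    · exact hexp t ht

/-- Solutions of a second order linear differential inequality that decay faster than every
exponential vanish. -/
lemma eventually_eq_zero_of_forall_isBigO_exp {v v' v'' : ℝ → E}
    (h1 : ∀ᶠ s in atTop, HasDerivAt v (v' s) s) (h2 : ∀ᶠ s in atTop, HasDerivAt v' (v'' s) s)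
    (hle : v'' =O[atTop] v) (hv : ∀ k : ℝ, v =O[atTop] fun s => Real.exp (-k * s)) :
    ∀ᶠ s in atTop, v s = 0 := by
  obtain ⟨L, hL0, hL⟩ := hle.exists_pos
  -- Integrating `|v''| ≤ L |v|` twice from infinity against `e^{-k s}` costs a factor `L / k²`,
  -- which is at most `1/2` for this `k`.
  set k : ℝ := L + 2 with hk
  have hk0 : 0 < k := by positivity
  have hv't : Tendsto v' atTop (𝓝 0) :=
    (isBigO_exp_deriv hk0.le h1 h2 (hv k) (hle.trans (hv k))).trans_tendsto
      (tendsto_exp_neg_mul_atTop hk0)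
  have hvt : Tendsto v atTop (𝓝 0) := (hv k).trans_tendsto (tendsto_exp_neg_mul_atTop hk0)
  obtain ⟨C, hC⟩ := (hv k).bound
  obtain ⟨S, hS⟩ := eventually_atTop.1 (h1.and (h2.and (hL.bound.and hC)))
  simp only [Real.norm_eq_abs, Real.abs_exp] at hS
  have step : ∀ {f f' : ℝ → ℝ} {D : ℝ}, Tendsto f atTop (𝓝 0) →
      (∀ s, S ≤ s → HasDerivAt f (f' s) s) → (∀ s, S ≤ s → |f' s| ≤ D * Real.exp (-k * s)) →
      ∀ s, S ≤ s → |f s| ≤ D / k * Real.exp (-k * s) := by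
    intro f f' D hf hd hb
    obtain ⟨l, hl⟩ := exists_abs_sub_le_of_abs_deriv_le_exp hk0 hd hb
    have hl0 : l = 0 := by
      refine tendsto_nhds_unique (f := f) (l := atTop) ?_ hf
      rw [tendsto_iff_norm_sub_tendsto_zero]
      have h3 := (tendsto_exp_neg_mul_atTop hk0).const_mul (D / k)
      rw [mul_zero] at h3
      exact squeeze_zero' (Eventually.of_forall fun _ => norm_nonneg _)
        (eventually_atTop.2 ⟨S, fun s hs => hl s hs⟩) h3
    simpa [hl0] using hl
  have halve : ∀ D : ℝ, (∀ s, S ≤ s → ‖v s‖ ≤ D * Real.exp (-k * s)) →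
      ∀ s, S ≤ s → ‖v s‖ ≤ D / 2 * Real.exp (-k * s) := by
    intro D hD s hs
    have hD0 : 0 ≤ D :=
      nonneg_of_mul_nonneg_left ((norm_nonneg _).trans (hD S le_rfl)) (Real.exp_pos _)
    -- A norming functional for the fixed vector `v s` reduces the double integration to scalar
    -- functions.
    obtain ⟨p, hp1, hp2⟩ := exists_dual_vector'' ℝ (v s)
    have hpt : ∀ {x : ℝ → E}, Tendsto x atTop (𝓝 0) →
        Tendsto (fun s => p (x s)) atTop (𝓝 0) := by
      intro x hx
      have := (p.continuous.tendsto 0).comp hx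
      rwa [map_zero] at this
    have h3 := step (hpt hv't) (fun s hs => p.hasFDerivAt.comp_hasDerivAt s (hS s hs).2.1)
      (D := L * D) (fun s hs => by
        calc |p (v'' s)| ≤ 1 * ‖v'' s‖ := p.le_of_opNorm_le hp1 _
          _ ≤ L * ‖v s‖ := by rw [one_mul]; exact (hS s hs).2.2.1
          _ ≤ L * (D * Real.exp (-k * s)) := by gcongr; exact hD s hs
          _ = _ := by ring)
    have h4 := step (hpt hvt) (fun s hs => p.hasFDerivAt.comp_hasDerivAt s (hS s hs).1) h3 s hs
    rw [hp2] at h4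
    have h5 : ‖v s‖ ≤ L * D / k / k * Real.exp (-k * s) := (le_abs_self _).trans h4
    refine h5.trans ?_
    gcongr ?_ * _
    rw [div_div, div_le_div_iff₀ (by positivity) (by norm_num)]
    nlinarith [mul_nonneg hD0 hL0.le, mul_nonneg hD0 (mul_nonneg hL0.le hL0.le)]
  have hpow : ∀ n : ℕ, ∀ s, S ≤ s → ‖v s‖ ≤ C / 2 ^ n * Real.exp (-k * s) := by
    intro n
    induction n with
    | zero => intro s hs; simpa using (hS s hs).2.2.2
    | succ n ih =>
      intro s hs
      rw [pow_succ, ← div_div]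
      exact halve _ ih s hs
  refine eventually_atTop.2 ⟨S, fun s hs => norm_le_zero_iff.1 ?_⟩
  have h6 : Tendsto (fun n : ℕ => C / 2 ^ n * Real.exp (-k * s)) atTop (𝓝 0) := by
    have := ((tendsto_pow_atTop_nhds_zero_of_lt_one (r := (1 / 2 : ℝ)) (by norm_num)
      (by norm_num)).const_mul C).mul_const (Real.exp (-k * s))
    simpa [div_eq_mul_inv] using this
  exact ge_of_tendsto' h6 fun n => hpow n s hs

variable {ι : Type*} [Fintype ι] {b : Module.Basis ι ℝ E} {H : E →L[ℝ] E} {ν : ι → ℝ}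

lemma Module.Basis.norm_sq_le (b : Module.Basis ι ℝ E) (x : E) :
    ‖x‖ ^ 2 ≤ (∑ i, ‖b i‖ ^ 2) * ∑ i, b.coord i x ^ 2 := by
  have h1 : ‖x‖ ≤ ∑ i, ‖b i‖ * |b.coord i x| := by
    conv_lhs => rw [← b.sum_repr x]
    refine (norm_sum_le _ _).trans (le_of_eq (Finset.sum_congr rfl fun i _ => ?_))
    rw [_root_.norm_smul, mul_comm, Real.norm_eq_abs, Module.Basis.coord_apply]
  have h2 := Finset.sum_mul_sq_le_sq_mul_sq Finset.univ (fun i => ‖b i‖) fun i => |b.coord i x|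
  simp only [sq_abs] at h2
  exact (pow_le_pow_left₀ (norm_nonneg _) h1 2).trans h2

/-- Coordinates in an eigenbasis decouple the linear part; neither symmetry of `H` nor orthogonality
of `b` is needed. -/
lemma Module.Basis.coord_apply_eigen (hb : ∀ i, H (b i) = ν i ^ 2 • b i) (i : ι) (x : E) :
    b.coord i (H x) = ν i ^ 2 * b.coord i x := by
  classical
  conv_lhs => rw [← b.sum_repr x, map_sum, map_sum]
  simp [-Module.Basis.sum_repr, hb, Finsupp.single_apply, mul_comm]

variable [FiniteDimensional ℝ E]

/-- Solutions of `v'' = H v + O(|v|²)` that tend to `0` do so exponentially fast. -/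
lemma exists_isBigO_exp_of_tendsto_zero (hν0 : ∀ i, 0 < ν i)
    (hb : ∀ i, H (b i) = ν i ^ 2 • b i) {v v' g : ℝ → E}
    (h1 : ∀ᶠ s in atTop, HasDerivAt v (v' s) s)
    (h2 : ∀ᶠ s in atTop, HasDerivAt v' (H (v s) + g s) s)
    (hv : Tendsto v atTop (𝓝 0)) (hv' : v' =O[atTop] fun _ => (1 : ℝ))
    (hg : g =O[atTop] fun s => ‖v s‖ ^ 2) :
    ∃ k : ℝ, 0 < k ∧ v =O[atTop] fun s => Real.exp (-k * s) := by
  obtain ⟨c, hc, hcν⟩ : ∃ c : ℝ, 0 < c ∧ ∀ i, c ≤ ν i := by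
    have : ∀ᶠ c in 𝓝[>] (0 : ℝ), ∀ i, c ≤ ν i := by
      rw [eventually_all]
      exact fun i => mem_nhdsWithin_of_mem_nhds ((eventually_lt_nhds (hν0 i)).mono fun _ => le_of_lt)
    obtain ⟨c, h, hc⟩ := (this.and self_mem_nhdsWithin).exists
    exact ⟨c, hc, h⟩
  let p : ι → E →L[ℝ] ℝ := fun i => LinearMap.toContinuousLinearMap (b.coord i)
  have hpc : ∀ i x, p i x = b.coord i x := fun i x => rfl
  set B : ℝ := ∑ i, ‖b i‖ ^ 2 with hB
  have hB0 : 0 ≤ B := by positivity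
  have hnorm : ∀ x, ‖x‖ ^ 2 ≤ B * ∑ i, p i x ^ 2 := fun x => b.norm_sq_le x
  have hvO : v =O[atTop] fun _ => (1 : ℝ) := hv.isBigO_one ℝ
  have hpO : ∀ i (x : ℝ → E), (fun s => p i (x s)) =O[atTop] x := fun i x =>
    (p i).isBigO_comp x atTop
  have hsmall : (fun s => ∑ i, p i (v s) * p i (g s)) =o[atTop] fun s => ‖v s‖ ^ 2 := by
    refine Asymptotics.IsLittleO.fun_sum fun i _ => ?_
    have h3 : (fun s => p i (v s)) =o[atTop] fun _ => (1 : ℝ) :=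
      (hpO i v).trans_isLittleO ((Asymptotics.isLittleO_one_iff ℝ).2 hv)
    simpa using h3.mul_isBigO ((hpO i g).trans hg)
  obtain ⟨C, hC⟩ := exists_le_exp_of_deriv2_ge (φ := fun s => ∑ i, p i (v s) ^ 2)
    (φ' := fun s => ∑ i, 2 * (p i (v s) * p i (v' s)))
    (φ'' := fun s => ∑ i, 2 * (p i (v' s) * p i (v' s) + p i (v s) * p i (H (v s) + g s))) hc
    (by
      filter_upwards [h1] with s hs
      refine HasDerivAt.fun_sum fun i _ => ?_
      refine (((p i).hasFDerivAt.comp_hasDerivAt s hs).pow 2).congr_deriv ?_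
      simp
      ring)
    (by
      filter_upwards [h1, h2] with s hs hs'
      refine HasDerivAt.fun_sum fun i _ => ?_
      exact (((p i).hasFDerivAt.comp_hasDerivAt s hs).mul
        ((p i).hasFDerivAt.comp_hasDerivAt s hs')).const_mul 2)
    (by
      -- With this `ε` the cross term costs at most `c² φ` of the `2 c² φ` supplied by `H`.
      have hε : 0 < c ^ 2 / (2 * (B + 1)) := by positivity
      filter_upwards [hsmall.bound hε] with s hs
      have h3 : ∑ i, 2 * (p i (v' s) * p i (v' s) + p i (v s) * p i (H (v s) + g s)) =
          2 * ∑ i, p i (v' s) ^ 2 + 2 * ∑ i, ν i ^ 2 * p i (v s) ^ 2 +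
            2 * ∑ i, p i (v s) * p i (g s) := by
        rw [Finset.mul_sum, Finset.mul_sum, Finset.mul_sum, ← Finset.sum_add_distrib,
          ← Finset.sum_add_distrib]
        refine Finset.sum_congr rfl fun i _ => ?_
        rw [map_add, hpc i (H _), Module.Basis.coord_apply_eigen hb, ← hpc]
        ring
      have h4 : 0 ≤ ∑ i, p i (v' s) ^ 2 := by positivity
      have h5 : c ^ 2 * ∑ i, p i (v s) ^ 2 ≤ ∑ i, ν i ^ 2 * p i (v s) ^ 2 := by
        rw [Finset.mul_sum]
        gcongr with i
        exact hcν i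
      have h0 : 0 ≤ ∑ i, p i (v s) ^ 2 := by positivity
      rw [Real.norm_eq_abs, norm_pow, norm_norm] at hs
      have h6 : c ^ 2 / (2 * (B + 1)) * ‖v s‖ ^ 2 ≤ c ^ 2 / 2 * ∑ i, p i (v s) ^ 2 := by
        calc c ^ 2 / (2 * (B + 1)) * ‖v s‖ ^ 2
            ≤ c ^ 2 / (2 * (B + 1)) * ((B + 1) * ∑ i, p i (v s) ^ 2) := by
              gcongr
              exact (hnorm _).trans (by gcongr; linarith)
          _ = _ := by field_simp
      have h7 := neg_abs_le (∑ i, p i (v s) * p i (g s))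
      rw [h3]
      nlinarith)
    (by
      refine Asymptotics.IsBigO.fun_sum fun i _ => ?_
      simpa using ((hpO i v).trans hvO).pow 2)
    (by
      refine Asymptotics.IsBigO.fun_sum fun i _ => ?_
      refine Asymptotics.IsBigO.const_mul_left ?_ 2
      simpa using ((hpO i v).trans hvO).mul ((hpO i v').trans hv'))
  refine ⟨c / 2, by positivity, ?_⟩
  have h3 : (fun s => ‖v s‖ ^ 2) =O[atTop] fun s => Real.exp (-(c / 2) * s) ^ 2 := by
    refine Asymptotics.IsBigO.of_bound (B * C) ?_
    filter_upwards [hC] with s hs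
    rw [norm_pow, norm_norm, norm_pow, Real.norm_eq_abs, Real.abs_exp, ← Real.exp_nat_mul,
      show ((2 : ℕ) : ℝ) * (-(c / 2) * s) = -c * s by push_cast; ring, mul_assoc]
    exact (hnorm _).trans (by gcongr)
  exact (Asymptotics.IsBigO.of_pow two_ne_zero h3).of_norm_left

/-- Leading exponential term of a nontrivial solution of `v'' = H v + O(|v|²)` tending to `0`. -/
theorem exists_leading_exp_term (hν : Function.Injective ν) (hν0 : ∀ i, 0 < ν i)
    (hb : ∀ i, H (b i) = ν i ^ 2 • b i) {v v' g : ℝ → E}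
    (h1 : ∀ᶠ s in atTop, HasDerivAt v (v' s) s)
    (h2 : ∀ᶠ s in atTop, HasDerivAt v' (H (v s) + g s) s)
    (hv : Tendsto v atTop (𝓝 0)) (hg : g =O[atTop] fun s => ‖v s‖ ^ 2)
    (hne : ¬ ∀ᶠ s in atTop, v s = 0) :
    ∃ (i : ι) (K μp : ℝ), K ≠ 0 ∧ ν i < μp ∧ μp ≤ 2 * ν i ∧
      (fun s => v s - (K * Real.exp (-ν i * s)) • b i) =O[atTop] fun s => Real.exp (-μp * s) := by
  have hvO : v =O[atTop] fun _ => (1 : ℝ) := hv.isBigO_one ℝ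
  have hgv : g =O[atTop] v := by
    have : (fun s => ‖v s‖ * ‖v s‖) =O[atTop] fun s => 1 * ‖v s‖ :=
      hvO.norm_left.mul (Asymptotics.isBigO_refl _ _)
    simp only [one_mul, ← sq] at this
    exact (hg.trans this).of_norm_right
  have hv''v : (fun s => H (v s) + g s) =O[atTop] v := (H.isBigO_comp v atTop).add hgv
  have hv'O : v' =O[atTop] fun _ => (1 : ℝ) := by
    have := isBigO_exp_deriv le_rfl h1 h2 (by simpa using hvO) (by simpa using hv''v.trans hvO)
    simpa using this
  obtain ⟨k₀, hk₀, hvk₀⟩ := exists_isBigO_exp_of_tendsto_zero hν0 hb h1 h2 hv hv'O hg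
  set Λ : Set ℝ := {k | v =O[atTop] fun s => Real.exp (-k * s)} with hΛ
  have hbdd : BddAbove Λ := by
    by_contra hbdd
    refine hne (eventually_eq_zero_of_forall_isBigO_exp h1 h2 hv''v fun k => ?_)
    obtain ⟨l, hl, hkl⟩ := not_bddAbove_iff.1 hbdd k
    exact hl.trans (isBigO_exp_neg_mul hkl.le)
  have hσ : k₀ ≤ sSup Λ := le_csSup hbdd hvk₀
  -- A rate `k > σ/2` gives `g` the rate `2k > σ`, which leaves room for `ρ` in `(σ, 2k)`; `ρ` also
  -- avoids the finitely many `ν i`, so that no resonance occurs.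
  obtain ⟨k, hk, hσk⟩ := exists_lt_of_lt_csSup ⟨k₀, hvk₀⟩
    (show sSup Λ / 2 < sSup Λ by linarith)
  obtain ⟨ρ, ⟨hσρ, hρk⟩, hρν⟩ := ((Ioo_infinite (show sSup Λ < 2 * k by linarith)).sdiff
    (finite_range ν)).nonempty
  have hρ0 : 0 < ρ := by linarith
  have hgρ : g =O[atTop] fun s => Real.exp (-ρ * s) := by
    have h3 : (fun s => ‖v s‖ ^ 2) =O[atTop] fun s => Real.exp (-k * s) ^ 2 := hk.norm_left.pow 2
    refine (hg.trans h3).trans ?_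
    simp only [← Real.exp_nat_mul]
    refine (isBigO_exp_neg_mul hρk.le).congr_left fun s => ?_
    congr 1
    push_cast
    ring
  let p : ι → E →L[ℝ] ℝ := fun i => LinearMap.toContinuousLinearMap (b.coord i)
  have hpc : ∀ i x, p i x = b.coord i x := fun i x => rfl
  have hpO : ∀ i (x : ℝ → E), (fun s => p i (x s)) =O[atTop] x := fun i x =>
    (p i).isBigO_comp x atTop
  have hexp : ∀ i, ∃ K : ℝ, (ρ < ν i → K = 0) ∧
      (fun s => p i (v s) - K * Real.exp (-ν i * s)) =O[atTop] fun s => Real.exp (-ρ * s) := by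
    intro i
    refine exists_expansion_of_deriv2_eq (f' := fun s => p i (v' s)) (g := fun s => p i (g s))
      (hν0 i) hρ0 (fun h => hρν ⟨i, h.symm⟩) ?_ ?_ ((hpO i g).trans hgρ) ((hpO i v).trans hvO)
      ((hpO i v').trans hv'O)
    · filter_upwards [h1] with s hs
      exact (p i).hasFDerivAt.comp_hasDerivAt s hs
    · filter_upwards [h2] with s hs
      refine ((p i).hasFDerivAt.comp_hasDerivAt s hs).congr_deriv ?_
      rw [map_add, hpc i (H _), Module.Basis.coord_apply_eigen hb, ← hpc]
  choose K hK0 hK using hexp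
  have hsum : (fun s => v s - ∑ i, (K i * Real.exp (-ν i * s)) • b i) =O[atTop]
      fun s => Real.exp (-ρ * s) := by
    have h3 : ∀ s, v s - ∑ i, (K i * Real.exp (-ν i * s)) • b i =
        ∑ i, (p i (v s) - K i * Real.exp (-ν i * s)) • b i := by
      intro s
      conv_lhs => rw [← b.sum_repr (v s)]
      rw [← Finset.sum_sub_distrib]
      exact Finset.sum_congr rfl fun i _ => (sub_smul _ _ _).symm
    simp only [h3]
    refine Asymptotics.IsBigO.fun_sum fun i _ => ?_
    have h4 : (fun s => (p i (v s) - K i * Real.exp (-ν i * s)) • b i) =O[atTop]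
        fun s => Real.exp (-ρ * s) • (1 : ℝ) :=
      (hK i).smul (Asymptotics.isBigO_const_const (b i) one_ne_zero atTop)
    simpa using h4
  classical
  -- If every `K i` vanished, `ρ` would be a decay rate of `v` beyond the supremum.
  obtain ⟨i, hi, hmin⟩ : ∃ i, K i ≠ 0 ∧ ∀ j, K j ≠ 0 → ν i ≤ ν j := by
    rcases (Finset.univ.filter fun i => K i ≠ 0).eq_empty_or_nonempty with he | hne'
    · have hz : ∀ i, K i = 0 := by
        intro i
        by_contra h
        have : i ∈ Finset.univ.filter fun i => K i ≠ 0 := by simpa using h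
        simp [he] at this
      have : ρ ∈ Λ := by
        simp only [hz, zero_mul, zero_smul, Finset.sum_const_zero, sub_zero] at hsum
        exact hsum
      linarith [le_csSup hbdd this]
    · obtain ⟨i, hi, hmin⟩ := Finset.exists_min_image _ ν hne'
      refine ⟨i, by simpa using hi, fun j hj => hmin j (by simpa using hj)⟩
  have hiρ : ν i < ρ := lt_of_le_of_ne (not_lt.1 fun h => hi (hK0 i h)) fun h => hρν ⟨i, h⟩
  -- Injectivity of `ν` makes every other active frequency strictly larger than `ν i`. The cap `2 *
  -- ν i` later absorbs quadratic errors.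
  obtain ⟨μp, ⟨h3, h4, h5⟩, h6⟩ : ∃ μp, (μp ≤ ρ ∧ μp ≤ 2 * ν i ∧
      ∀ j, K j ≠ 0 → j ≠ i → μp ≤ ν j) ∧ ν i < μp := by
    have hlt : ∀ {x : ℝ}, ν i < x → ∀ᶠ y in 𝓝[>] ν i, y ≤ x := fun h =>
      mem_nhdsWithin_of_mem_nhds ((eventually_lt_nhds h).mono fun _ => le_of_lt)
    have hall : ∀ᶠ y in 𝓝[>] ν i, ∀ j, K j ≠ 0 → j ≠ i → y ≤ ν j := by
      rw [eventually_all]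
      intro j
      by_cases hj : K j ≠ 0 ∧ j ≠ i
      · filter_upwards [hlt (lt_of_le_of_ne (hmin j hj.1) fun h => hj.2 (hν h.symm))]
          with y hy _ _ using hy
      · exact Eventually.of_forall fun y h h' => absurd ⟨h, h'⟩ hj
    exact (((hlt hiρ).and ((hlt (by linarith [hν0 i])).and hall)).and self_mem_nhdsWithin).exists
  refine ⟨i, K i, μp, hi, h6, h4, ?_⟩
  have h7 : ∀ s, v s - (K i * Real.exp (-ν i * s)) • b i =
      (v s - ∑ j, (K j * Real.exp (-ν j * s)) • b j) +
        ∑ j ∈ Finset.univ.erase i, (K j * Real.exp (-ν j * s)) • b j := by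
    intro s
    rw [← Finset.add_sum_erase _ _ (Finset.mem_univ i)]
    abel
  simp only [h7]
  refine (hsum.trans (isBigO_exp_neg_mul h3)).add (Asymptotics.IsBigO.fun_sum fun j hj => ?_)
  by_cases hj0 : K j = 0
  · simpa [hj0] using Asymptotics.isBigO_zero _ _
  · have h8 : (fun s => (K j * Real.exp (-ν j * s)) • b j) =O[atTop]
        fun s => Real.exp (-μp * s) • (1 : ℝ) :=
      ((isBigO_exp_neg_mul (h5 j hj0 (Finset.ne_of_mem_erase hj))).const_mul_left _).smul
        (Asymptotics.isBigO_const_const (b j) one_ne_zero atTop)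
    simpa using h8

end

/-! ### Taylor remainder, unique continuation, regularity -/

lemma ContDiff.gradient {F : Type*} [NormedAddCommGroup F] [InnerProductSpace ℝ F]
    [CompleteSpace F] {f : F → ℝ} {n : ℕ} (hf : ContDiff ℝ (n + 1 : ℕ) f) :
    ContDiff ℝ n (gradient f) :=
  (InnerProductSpace.toDual ℝ F).symm.toContinuousLinearEquiv.contDiff.comp
    (hf.fderiv_right (by norm_cast))

section

variable {E : Type*} [NormedAddCommGroup E] [NormedSpace ℝ E] {G : E → E} {a : E} {u : ℝ → E}

/-- First order Taylor formula with quadratic remainder. -/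
lemma isBigO_sub_sub_fderiv (hG : ContDiff ℝ 2 G) (a : E) :
    (fun x => G x - G a - fderiv ℝ G a (x - a)) =O[𝓝 a] fun x => ‖x - a‖ ^ 2 := by
  have hd : DifferentiableAt ℝ (fderiv ℝ G) a :=
    ((hG.fderiv_right (m := 1) (by norm_num)).differentiable one_ne_zero).differentiableAt
  obtain ⟨C, hC0, hC⟩ := hd.isBigO_sub.exists_pos
  obtain ⟨r, hr, hball⟩ := Metric.eventually_nhds_iff_ball.1 hC.bound
  refine Asymptotics.IsBigO.of_bound C ?_
  filter_upwards [Metric.ball_mem_nhds a hr] with x hx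
  have hsub : ∀ y ∈ Metric.closedBall a ‖x - a‖, y ∈ Metric.ball a r ∧ ‖y - a‖ ≤ ‖x - a‖ := by
    intro y hy
    rw [mem_closedBall_iff_norm] at hy
    rw [mem_ball_iff_norm] at hx ⊢
    exact ⟨hy.trans_lt hx, hy⟩
  -- Mean value inequality on the ball of radius `‖x - a‖`, where the derivative of `G` varies by at
  -- most `C * ‖x - a‖`.
  have h := (convex_closedBall a ‖x - a‖).norm_image_sub_le_of_norm_fderiv_le' (f := G)
    (φ := fderiv ℝ G a) (C := C * ‖x - a‖) (x := a) (y := x) (𝕜 := ℝ)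
    (fun y _ => (hG.differentiable two_ne_zero).differentiableAt)
    (fun y hy => (hball y (hsub y hy).1).trans (by gcongr; exact (hsub y hy).2))
    (Metric.mem_closedBall_self (norm_nonneg _)) (by rw [mem_closedBall_iff_norm])
  rw [norm_pow, norm_norm, sq, ← mul_assoc]
  exact h

variable (hu : ∀ s, 0 < s → DifferentiableAt ℝ u s ∧ HasDerivAt (deriv u) (G (u s)) s)
include hu

/-- Unique continuation from a neighbourhood of `+∞`. -/
lemma eq_equilibrium_of_eventually_eq (hG : ContDiff ℝ 1 G) (ha : G a = 0)
    (h : ∀ᶠ s in atTop, u s = a) : ∀ s, 0 < s → u s = a := by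
  intro s hs
  obtain ⟨S, hS⟩ := eventually_atTop.1 h
  -- Strictly beyond `S`, so `u` is constant near `T` and both `u` and `u'` match the equilibrium
  -- there.
  set T : ℝ := max S s + 1 with hT
  have hsT : s ≤ T := by linarith [le_max_right S s]
  have hST : S < T := by linarith [le_max_left S s]
  have huT : u =ᶠ[𝓝 T] fun _ => a := (eventually_gt_nhds hST).mono fun t ht => hS t ht.le
  have hderiv : ∀ t, 0 < t → HasDerivAt (fun t => (u t, deriv u t)) (deriv u t, G (u t)) t :=
    fun t ht => (hu t ht).1.hasDerivAt.prodMk (hu t ht).2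
  have hcont : ContinuousOn (fun t => (u t, deriv u t)) (Icc s T) := fun t ht =>
    (hderiv t (hs.trans_le ht.1)).continuousAt.continuousWithinAt
  have hV : ContDiff ℝ 1 fun p : E × E => (p.2, G p.1) :=
    contDiff_snd.prodMk (hG.comp contDiff_fst)
  obtain ⟨K, hK⟩ := (hV.locallyLipschitz.locallyLipschitzOn).exists_lipschitzOnWith_of_compact
    ((isCompact_Icc.image_of_continuousOn hcont).union (isCompact_singleton (x := (a, (0 : E)))))
  have := ODE_solution_unique_of_mem_Icc_left (v := fun _ p => (p.2, G p.1))
    (f := fun t => (u t, deriv u t)) (g := fun _ => (a, 0)) (a := s) (b := T) (K := K)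
    (s := fun _ => ((fun t => (u t, deriv u t)) '' Icc s T) ∪ {(a, 0)})
    (fun t _ => hK) hcont
    (fun t ht => (hderiv t (hs.trans ht.1)).hasDerivWithinAt)
    (fun t ht => Or.inl ⟨t, Ioc_subset_Icc_self ht, rfl⟩) continuousOn_const
    (fun t _ => by
      simp only [ha]
      exact hasDerivWithinAt_const t (Iic t) (a, (0 : E)))
    (fun t _ => Or.inr rfl)
    (by simp [huT.deriv_eq, hS T hST.le])
  exact congrArg Prod.fst (this ⟨le_rfl, hsT⟩)

/-- Bootstrap: `G ∘ u` inherits the regularity of `u` as far as `G` permits, and integrating the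
equation gains two derivatives. -/
lemma contDiffOn_solution {n : ℕ} (hG : ContDiff ℝ n G) :
    ContDiffOn ℝ (n + 2 : ℕ) u (Ioi 0) := by
  have key : ∀ {k : ℕ}, ContDiffOn ℝ k (fun s => G (u s)) (Ioi 0) →
      ContDiffOn ℝ (k + 2 : ℕ) u (Ioi 0) := by
    intro k hk
    rw [show ((k + 2 : ℕ) : WithTop ℕ∞) = ((k : WithTop ℕ∞) + 1) + 1 by norm_cast,
      contDiffOn_succ_iff_deriv_of_isOpen isOpen_Ioi]
    refine ⟨fun s hs => (hu s hs).1.differentiableWithinAt, fun h => absurd h (by norm_cast), ?_⟩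
    rw [contDiffOn_succ_iff_deriv_of_isOpen isOpen_Ioi]
    refine ⟨fun s hs => (hu s hs).2.differentiableAt.differentiableWithinAt,
      fun h => absurd h (by norm_cast), ?_⟩
    exact hk.congr fun s hs => (hu s hs).2.deriv
  induction n with
  | zero =>
    refine key ?_
    rw [Nat.cast_zero, contDiffOn_zero]
    exact hG.continuous.comp_continuousOn fun s hs =>
      (hu s hs).1.continuousAt.continuousWithinAt
  | succ n ih =>
    refine key (hG.comp_contDiffOn ((ih (hG.of_le (by norm_cast; simp))).of_le ?_))
    norm_cast
    omega

end

/-! ### Expansion of the derivatives up to order three -/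

/-- The iterated derivatives on an open set of a function with a given chain of derivatives. -/
lemma iteratedDeriv_eq_of_hasDerivAt {E : Type*} [NormedAddCommGroup E] [NormedSpace ℝ E]
    {f : ℕ → ℝ → E} {U : Set ℝ} (hU : IsOpen U) {n : ℕ}
    (h : ∀ k < n, ∀ s ∈ U, HasDerivAt (f k) (f (k + 1) s) s) :
    ∀ k ≤ n, ∀ s ∈ U, iteratedDeriv k (f 0) s = f k s := by
  intro k
  induction k with
  | zero => simp
  | succ k ih =>
    intro hk s hs
    rw [iteratedDeriv_succ]
    have : iteratedDeriv k (f 0) =ᶠ[𝓝 s] f k :=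
      (hU.eventually_mem hs).mono fun t ht => ih (by omega) t ht
    rw [this.deriv_eq]
    exact (h k (by omega) s hs).deriv

/-- The derivatives of order `0, …, 3` of `u - a`, for a solution `u` of `u'' = G u`. -/
noncomputable def newtonDeriv {E : Type*} [NormedAddCommGroup E] [NormedSpace ℝ E] (G : E → E)
    (a : E) (u : ℝ → E) : ℕ → ℝ → E
  | 0 => fun s => u s - a
  | 1 => deriv u
  | 2 => fun s => G (u s)
  -- This case is meant for order 3; larger indices carry no meaning.
  | _ => fun s => fderiv ℝ G (u s) (deriv u s)

section

variable {E : Type*} [NormedAddCommGroup E] [NormedSpace ℝ E] {G : E → E} {a : E} {u : ℝ → E}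
  (hu : ∀ s, 0 < s → DifferentiableAt ℝ u s ∧ HasDerivAt (deriv u) (G (u s)) s)
include hu

lemma hasDerivAt_newtonDeriv (hG : Differentiable ℝ G) (a : E) :
    ∀ k < 3, ∀ s ∈ Ioi (0 : ℝ), HasDerivAt (newtonDeriv G a u k) (newtonDeriv G a u (k + 1) s) s := by
  intro k hk s hs
  interval_cases k
  · exact (hu s hs).1.hasDerivAt.sub_const a
  · exact (hu s hs).2
  · exact (hG (u s)).hasFDerivAt.comp_hasDerivAt s (hu s hs).1.hasDerivAt

/-- On a bounded interval, boundedness of a solution passes to its derivatives. -/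
lemma exists_norm_newtonDeriv_le [FiniteDimensional ℝ E] (hG : ContDiff ℝ 1 G) (a : E) {s₁ S : ℝ}
    (hs₁ : 0 ≤ s₁) (hS : 0 < S) (hb : Bornology.IsBounded (u '' Ioc s₁ S)) :
    ∃ C, ∀ s ∈ Ioc s₁ S, ∀ k ≤ 3, ‖newtonDeriv G a u k s‖ ≤ C := by
  have hcomp : IsCompact (closure (u '' Ioc s₁ S)) := hb.isCompact_closure
  have hmem : ∀ s ∈ Ioc s₁ S, u s ∈ closure (u '' Ioc s₁ S) := fun s hs =>
    subset_closure ⟨s, hs, rfl⟩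
  obtain ⟨C₀, hC₀⟩ := hcomp.exists_bound_of_continuousOn
    (f := fun x => x - a) (by fun_prop)
  obtain ⟨C₂, hC₂⟩ := hcomp.exists_bound_of_continuousOn hG.continuous.continuousOn
  obtain ⟨C₃, hC₃⟩ := hcomp.exists_bound_of_continuousOn
    (hG.continuous_fderiv one_ne_zero).continuousOn
  -- Integrate `u'' = G u` back from the right end `S`, since `u` need not extend to `s₁ = 0`.
  have h1 : ∀ s ∈ Ioc s₁ S, ‖deriv u s‖ ≤ |C₂| * S + ‖deriv u S‖ := by
    intro s hs
    have := (convex_Ioc s₁ S).norm_image_sub_le_of_norm_hasDerivWithin_le (f := deriv u)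
      (f' := fun s => G (u s)) (C := |C₂|)
      (fun t ht => (hu t (hs₁.trans_lt ht.1)).2.hasDerivWithinAt)
      (fun t ht => (hC₂ _ (hmem t ht)).trans (le_abs_self _))
      (⟨hs.1.trans_le hs.2, le_rfl⟩ : S ∈ Ioc s₁ S) hs
    have h2 : ‖s - S‖ ≤ S := by
      rw [Real.norm_eq_abs, abs_le]
      constructor <;> linarith [hs.1, hs.2]
    have h3 := norm_le_norm_add_norm_sub' (deriv u s) (deriv u S)
    nlinarith [mul_le_mul_of_nonneg_left h2 (abs_nonneg C₂)]
  refine ⟨|C₀| + (|C₂| * S + ‖deriv u S‖) + |C₂| + |C₃| * (|C₂| * S + ‖deriv u S‖), ?_⟩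
  intro s hs k hk
  have e0 := abs_nonneg C₀
  have e1 : 0 ≤ |C₂| * S + ‖deriv u S‖ := by positivity
  have e2 := abs_nonneg C₂
  have e3 : 0 ≤ |C₃| * (|C₂| * S + ‖deriv u S‖) := by positivity
  interval_cases k
  · exact ((hC₀ _ (hmem s hs)).trans (le_abs_self _)).trans (by linarith)
  · exact (h1 s hs).trans (by linarith)
  · exact ((hC₂ _ (hmem s hs)).trans (le_abs_self _)).trans (by linarith)
  · have : ‖fderiv ℝ G (u s) (deriv u s)‖ ≤ |C₃| * (|C₂| * S + ‖deriv u S‖) :=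
      ((fderiv ℝ G (u s)).le_opNorm _).trans (mul_le_mul
        ((hC₃ _ (hmem s hs)).trans (le_abs_self _)) (h1 s hs) (norm_nonneg _) (abs_nonneg _))
    exact this.trans (by linarith)

end

/-- Uniform exponential bounds on a half-line from bounds near `+∞` and on bounded intervals. -/
lemma exists_forall_norm_le_exp {E : Type*} [NormedAddCommGroup E] {μp : ℝ} {f : ℕ → ℝ → E}
    {n : ℕ} {s₁ : ℝ} (hμp : 0 < μp)
    (hf : ∀ k ≤ n, f k =O[atTop] fun s => Real.exp (-μp * s))
    (hb : ∀ S, 0 < S → ∃ C, ∀ s ∈ Ioc s₁ S, ∀ k ≤ n, ‖f k s‖ ≤ C) :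
    ∃ Kp, 0 < Kp ∧ ∀ s, s₁ < s → ∀ k ≤ n, ‖f k s‖ ≤ Kp * Real.exp (-μp * s) := by
  have h1 : ∀ k ≤ n, ∃ D, ∀ s, s₁ < s → ‖f k s‖ ≤ D * Real.exp (-μp * s) := by
    intro k hk
    obtain ⟨c, hc⟩ := (hf k hk).bound
    obtain ⟨S, hS⟩ := eventually_atTop.1 hc
    obtain ⟨C, hC⟩ := hb (max S 1) (by positivity)
    refine ⟨|c| + |C| * Real.exp (μp * max S 1), fun s hs => ?_⟩
    rw [add_mul]
    rcases le_total s (max S 1) with h | h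
    · have h2 : 1 ≤ Real.exp (μp * max S 1) * Real.exp (-μp * s) := by
        rw [← Real.exp_add]
        exact Real.one_le_exp (by nlinarith)
      have h3 : ‖f k s‖ ≤ |C| := (hC s ⟨hs, h⟩ k hk).trans (le_abs_self _)
      have h4 : 0 ≤ |c| * Real.exp (-μp * s) := by positivity
      nlinarith [abs_nonneg C]
    · have h3 := hS s ((le_max_left _ _).trans h)
      rw [Real.norm_eq_abs, Real.abs_exp] at h3
      have h4 : 0 ≤ |C| * Real.exp (μp * max S 1) * Real.exp (-μp * s) := by positivity
      nlinarith [le_abs_self c, Real.exp_pos (-μp * s)]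
  choose! D hD using h1
  refine ⟨∑ k ∈ Finset.range (n + 1), |D k| + 1, by positivity, fun s hs k hk => ?_⟩
  refine (hD k hk s hs).trans ?_
  gcongr
  have := Finset.single_le_sum (f := fun k => |D k|) (fun i _ => abs_nonneg _)
    (Finset.mem_range.2 (Nat.lt_succ_of_le hk))
  linarith [le_abs_self (D k)]

section

variable {E : Type*} [NormedAddCommGroup E] [NormedSpace ℝ E] {G : E → E} {a y : E} {u : ℝ → E}
  {μ μp : ℝ}

/-- The direction of a function with a leading exponential term. -/
lemma tendsto_normalize_of_isBigO {v : ℝ → E} (hμ : μ < μp) (hy : y ≠ 0)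
    (hv : (fun s => v s - Real.exp (-μ * s) • y) =O[atTop] fun s => Real.exp (-μp * s)) :
    Tendsto (fun s => ‖v s‖⁻¹ • v s) atTop (𝓝 (‖y‖⁻¹ • y)) := by
  have h1 : Tendsto (fun s => Real.exp (μ * s) • v s) atTop (𝓝 y) := by
    rw [← tendsto_sub_nhds_zero_iff]
    have h2 : (fun s => Real.exp (μ * s) • (v s - Real.exp (-μ * s) • y)) =O[atTop]
        fun s => Real.exp (μ * s) • Real.exp (-μp * s) :=
      (Asymptotics.isBigO_refl _ _).smul hv
    refine (h2.congr (fun s => ?_) fun s => ?_).trans_tendsto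
      (tendsto_exp_neg_mul_atTop (sub_pos.2 hμ))
    · rw [smul_sub, smul_smul, ← Real.exp_add, neg_mul, add_neg_cancel, Real.exp_zero, one_smul]
    · rw [smul_eq_mul, ← Real.exp_add]
      congr 1
      ring
  have h3 := (h1.norm.inv₀ (norm_ne_zero_iff.2 hy)).smul h1
  refine h3.congr fun s => ?_
  have := (Real.exp_pos (μ * s)).ne'
  rw [norm_smul, Real.norm_eq_abs, Real.abs_exp, smul_smul]
  congr 1
  field_simp

lemma hasDerivAt_exp_neg_mul_smul (μ : ℝ) (y : E) (k : ℕ) (s : ℝ) :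
    HasDerivAt (fun s => ((-μ) ^ k * Real.exp (-μ * s)) • y)
      (((-μ) ^ (k + 1) * Real.exp (-μ * s)) • y) s := by
  refine ((((hasDerivAt_id s).const_mul (-μ)).exp.const_mul ((-μ) ^ k)).smul_const y).congr_deriv ?_
  congr 1
  simp only [id]
  ring

variable (hu : ∀ s, 0 < s → DifferentiableAt ℝ u s ∧ HasDerivAt (deriv u) (G (u s)) s)
include hu

/-- A leading exponential term of a solution may be differentiated. -/
lemma newtonDeriv_sub_isBigO (hG : ContDiff ℝ 2 G) (ha : G a = 0) (hua : Tendsto u atTop (𝓝 a))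
    (hμ0 : 0 < μ) (hμ : μ < μp) (hμ2 : μp ≤ 2 * μ) (hy : fderiv ℝ G a y = μ ^ 2 • y)
    (h : (fun s => u s - a - Real.exp (-μ * s) • y) =O[atTop] fun s => Real.exp (-μp * s)) :
    ∀ k ≤ 3, (fun s => newtonDeriv G a u k s - ((-μ) ^ k * Real.exp (-μ * s)) • y) =O[atTop]
      fun s => Real.exp (-μp * s) := by
  have he : (fun s => Real.exp (-μ * s) • y) =O[atTop] fun s => Real.exp (-μ * s) := by
    have : (fun s => Real.exp (-μ * s) • y) =O[atTop] fun s => Real.exp (-μ * s) • (1 : ℝ) :=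
      (Asymptotics.isBigO_refl _ _).smul (Asymptotics.isBigO_const_const y one_ne_zero atTop)
    simpa using this
  have hv : (fun s => u s - a) =O[atTop] fun s => Real.exp (-μ * s) := by
    simpa using (h.trans (isBigO_exp_neg_mul hμ.le)).add he
  have hsq : (fun s => Real.exp (-μ * s) * Real.exp (-μ * s)) =O[atTop]
      fun s => Real.exp (-μp * s) := by
    refine (isBigO_exp_neg_mul hμ2).congr_left fun s => ?_
    rw [← Real.exp_add]
    congr 1
    ring
  have hdG : DifferentiableAt ℝ (fderiv ℝ G) a :=
    ((hG.fderiv_right (m := 1) (by norm_num)).differentiable one_ne_zero).differentiableAt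
  have hg : (fun s => G (u s) - fderiv ℝ G a (u s - a)) =O[atTop] fun s => Real.exp (-μp * s) := by
    have h1 := (isBigO_sub_sub_fderiv hG a).comp_tendsto hua
    simp only [ha, sub_zero, Function.comp_def] at h1
    refine (h1.trans ?_).trans hsq
    simpa [sq] using hv.norm_left.mul hv.norm_left
  have h0' : (fun s => newtonDeriv G a u 0 s - ((-μ) ^ 0 * Real.exp (-μ * s)) • y) =O[atTop]
      fun s => Real.exp (-μp * s) := by
    simpa [newtonDeriv] using h
  have h2' : (fun s => newtonDeriv G a u 2 s - ((-μ) ^ 2 * Real.exp (-μ * s)) • y) =O[atTop]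
      fun s => Real.exp (-μp * s) := by
    refine ((((fderiv ℝ G a).isBigO_comp _ _).trans h).add hg).congr_left fun s => ?_
    simp only [newtonDeriv, map_sub, map_smul, hy, smul_smul]
    rw [show (-μ) ^ 2 * Real.exp (-μ * s) = Real.exp (-μ * s) * μ ^ 2 by ring]
    abel
  have hder : ∀ k < 3, ∀ᶠ s in atTop, HasDerivAt
      (fun s => newtonDeriv G a u k s - ((-μ) ^ k * Real.exp (-μ * s)) • y)
      (newtonDeriv G a u (k + 1) s - ((-μ) ^ (k + 1) * Real.exp (-μ * s)) • y) s := by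
    intro k hk
    filter_upwards [eventually_gt_atTop 0] with s hs
    exact (hasDerivAt_newtonDeriv hu (hG.differentiable two_ne_zero) a k hk s hs).sub
      (hasDerivAt_exp_neg_mul_smul μ y k s)
  have h1' := isBigO_exp_deriv (by linarith) (hder 0 (by norm_num)) (hder 1 (by norm_num)) h0' h2'
  have happ : ∀ {L : ℝ → E →L[ℝ] E} {x : ℝ → E} {p q : ℝ → ℝ}, L =O[atTop] p → x =O[atTop] q →
      (fun s => L s (x s)) =O[atTop] fun s => p s * q s := by
    intro L x p q hL hx
    have h3 : (fun s => L s (x s)) =O[atTop] fun s => ‖L s‖ * ‖x s‖ :=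
      Asymptotics.IsBigO.of_bound 1 (Eventually.of_forall fun s => by
        simpa using (L s).le_opNorm (x s))
    exact h3.trans (hL.norm_left.mul hx.norm_left)
  intro k hk
  interval_cases k
  · exact h0'
  · exact h1'
  · exact h2'
  · have h4 : (fun s => fderiv ℝ G (u s)) =O[atTop] fun _ => (1 : ℝ) :=
      ((hdG.continuousAt.tendsto.comp hua).isBigO_one ℝ)
    have h5 : (fun s => fderiv ℝ G (u s) - fderiv ℝ G a) =O[atTop] fun s => Real.exp (-μ * s) :=
      (hdG.isBigO_sub.comp_tendsto hua).trans hv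
    have h6 := happ h4 h1'
    simp only [one_mul] at h6
    -- With `r = u' + μ e^{-μs} y`, the error is `DG(u) r - (DG(u) - DG(a)) (μ e^{-μs} y)`; the
    -- second term is `O(e^{-2μs})`.
    refine (h6.add ((happ h5 (he.const_smul_left μ)).trans hsq).neg_left).congr_left fun s => ?_
    simp only [newtonDeriv, sub_apply, map_sub, map_smul, zero_add, pow_one]
    rw [show (-μ) ^ 3 * Real.exp (-μ * s) = -(μ * (Real.exp (-μ * s) * μ ^ 2)) by ring,
      show -μ * Real.exp (-μ * s) = -(μ * Real.exp (-μ * s)) by ring]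
    simp only [neg_smul, Pi.smul_apply, map_smul, smul_smul, hy, mul_assoc]
    abel

/-- Asymptotic expansion at `+∞` of a solution of `u'' = G u` that tends to a hyperbolic
equilibrium with simple real spectrum. -/
theorem exists_expansion_of_tendsto_equilibrium [FiniteDimensional ℝ E] {ι : Type*} [Fintype ι]
    (b : Module.Basis ι ℝ E) {ν : ι → ℝ} (hν : Function.Injective ν) (hν0 : ∀ i, 0 < ν i)
    (hb : ∀ i, fderiv ℝ G a (b i) = ν i ^ 2 • b i) (hG : ContDiff ℝ 2 G) (ha : G a = 0)
    (hua : Tendsto u atTop (𝓝 a)) (hne : ∃ s, 0 < s ∧ u s ≠ a) :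
    ∃ (z : E) (μ : ℝ), Tendsto (fun s => ‖u s - a‖⁻¹ • (u s - a)) atTop (𝓝 z) ∧ 0 < μ ∧
      Module.End.HasEigenvector (fderiv ℝ G a).toLinearMap (μ ^ 2) z ∧
      ∃ (K μp : ℝ), 0 < K ∧ μ < μp ∧
        ∀ s₁, 0 ≤ s₁ → (∀ S, 0 < S → Bornology.IsBounded (u '' Ioc s₁ S)) →
          ∃ Kp, 0 < Kp ∧ ∀ s, s₁ < s → ∀ k ≤ 3,
            ‖iteratedDeriv k (fun s => u s - a - (K * Real.exp (-μ * s)) • z) s‖ ≤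
              Kp * Real.exp (-μp * s) := by
  have hv0 : Tendsto (fun s => u s - a) atTop (𝓝 0) := tendsto_sub_nhds_zero_iff.2 hua
  obtain ⟨i, K, μp, hK, hμ, hμ2, hO⟩ := exists_leading_exp_term (b := b) hν hν0 hb
    (v := fun s => u s - a) (v' := deriv u) (g := fun s => G (u s) - fderiv ℝ G a (u s - a))
    (by
      filter_upwards [eventually_gt_atTop 0] with s hs
      exact (hu s hs).1.hasDerivAt.sub_const a)
    (by
      filter_upwards [eventually_gt_atTop 0] with s hs
      simpa using (hu s hs).2)
    hv0
    (by
      have h1 := (isBigO_sub_sub_fderiv hG a).comp_tendsto hua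
      simpa only [ha, sub_zero, Function.comp_def] using h1)
    (by
      intro h
      obtain ⟨s, hs, hsa⟩ := hne
      exact hsa (eq_equilibrium_of_eventually_eq hu (hG.of_le (by norm_num)) ha
        (h.mono fun t ht => sub_eq_zero.1 ht) s hs))
  -- The sign of `K` goes into the direction `y / ‖y‖`, so the final constant `‖y‖` is positive.
  set y : E := K • b i with hy
  set μ : ℝ := ν i with hμi
  have hμ0 : 0 < μ := hν0 i
  have hy0 : y ≠ 0 := smul_ne_zero hK (b.ne_zero i)
  have hyH : fderiv ℝ G a y = μ ^ 2 • y := by rw [hy, map_smul, hb, smul_comm]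
  have hO' : (fun s => u s - a - Real.exp (-μ * s) • y) =O[atTop] fun s => Real.exp (-μp * s) := by
    refine hO.congr_left fun s => ?_
    rw [hy, smul_smul, mul_comm]
  have hny : 0 < ‖y‖ := norm_pos_iff.2 hy0
  refine ⟨‖y‖⁻¹ • y, μ, tendsto_normalize_of_isBigO hμ hy0 hO', hμ0, ?_, ‖y‖, μp, hny, hμ, ?_⟩
  · rw [Module.End.hasEigenvector_iff, Module.End.mem_eigenspace_iff]
    refine ⟨?_, smul_ne_zero (inv_ne_zero hny.ne') hy0⟩
    rw [ContinuousLinearMap.coe_coe, map_smul, hyH, smul_comm]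
  -- Allowing `s₁ = 0` covers the bounded case, and `s₁ > 0` the local bounds.
  · intro s₁ hs₁ hbdd
    have hf0 : (fun s => u s - a - (‖y‖ * Real.exp (-μ * s)) • ‖y‖⁻¹ • y) =
        fun s => newtonDeriv G a u 0 s - ((-μ) ^ 0 * Real.exp (-μ * s)) • y := by
      funext s
      rw [smul_smul, pow_zero, one_mul, newtonDeriv]
      congr 2
      field_simp
    obtain ⟨Kp, hKp, hle⟩ := exists_forall_norm_le_exp (n := 3) (s₁ := s₁) (μp := μp)
      (f := fun k s => newtonDeriv G a u k s - ((-μ) ^ k * Real.exp (-μ * s)) • y) (by linarith)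
      (newtonDeriv_sub_isBigO hu hG ha hua hμ0 hμ hμ2 hyH hO')
      (by
        intro S hS
        obtain ⟨C, hC⟩ := exists_norm_newtonDeriv_le hu (hG.of_le (by norm_num)) a hs₁ hS
          (hbdd S hS)
        refine ⟨C + (1 + μ) ^ 3 * ‖y‖, fun s hs k hk => (norm_sub_le _ _).trans ?_⟩
        refine add_le_add (hC s hs k hk) ?_
        rw [norm_smul, norm_mul, norm_pow, norm_neg, Real.norm_eq_abs, Real.norm_eq_abs,
          Real.abs_exp, abs_of_pos hμ0]
        gcongr
        have h1 : μ ^ k ≤ (1 + μ) ^ 3 :=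
          (pow_le_pow_left₀ hμ0.le (by linarith) k).trans
            (pow_le_pow_right₀ (by linarith) hk)
        have h2 : Real.exp (-μ * s) ≤ 1 := Real.exp_le_one_iff.2 (by nlinarith [hs.1])
        exact (mul_le_of_le_one_right (by positivity) h2).trans h1)
    refine ⟨Kp, hKp, fun s hs k hk => ?_⟩
    rw [hf0, iteratedDeriv_eq_of_hasDerivAt (n := 3) isOpen_Ioi
      (f := fun k s => newtonDeriv G a u k s - ((-μ) ^ k * Real.exp (-μ * s)) • y)
      (fun k hk s hs => (hasDerivAt_newtonDeriv hu (hG.differentiable two_ne_zero) a k hk s hs).sub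
        (hasDerivAt_exp_neg_mul_smul μ y k s)) k hk s (hs₁.trans_lt hs)]
    exact hle s hs k hk

end

/-! ### Newton's equation on the two half-lines -/

/-- Asymptotic expansion at `+∞`. -/
theorem newton_expansion_atTop {m : ℕ} {W : EuclideanSpace ℝ (Fin m) → ℝ} (hW : ContDiff ℝ 4 W)
    {a : EuclideanSpace ℝ (Fin m)} (hWa : gradient W a = 0) (hH2 : HasDistinctPosEigenvalues W a)
    (u : ℝ → EuclideanSpace ℝ (Fin m)) (hu : IsNewtonSolutionOn W u (Ioi 0))
    (hua : Tendsto u atTop (𝓝 a)) (hne : ∃ s, 0 < s ∧ u s ≠ a) :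
    ∃ (z : EuclideanSpace ℝ (Fin m)) (μ : ℝ),
      Tendsto (fun s => ‖u s - a‖⁻¹ • (u s - a)) atTop (𝓝 z) ∧
      0 < μ ∧ Module.End.HasEigenvector (hessianAt W a).toLinearMap (μ ^ 2) z ∧
      ∃ (K μp : ℝ) (w : ℝ → EuclideanSpace ℝ (Fin m)), 0 < K ∧ μ < μp ∧
        (∀ n : ℕ, ContDiff ℝ n W → ContDiffOn ℝ (n + 1) w (Ioi 0)) ∧
        (∀ s, 0 < s → u s - a = (K * Real.exp (-μ * s)) • z + w s) ∧
        (∀ s₀, 0 < s₀ → ∃ Kp, 0 < Kp ∧ ∀ s, s₀ ≤ s → ∀ k ≤ 3,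
          ‖iteratedDeriv k w s‖ ≤ Kp * Real.exp (-μp * s)) ∧
        (Bornology.IsBounded (u '' Ioi 0) → ∃ Kp, 0 < Kp ∧ ∀ s, 0 < s → ∀ k ≤ 3,
          ‖iteratedDeriv k w s‖ ≤ Kp * Real.exp (-μp * s)) := by
  obtain ⟨ev, hev, hspec⟩ := hH2
  choose hev0 hval using hspec
  choose e he using fun i => (hval i).exists_hasEigenvector
  let b := basisOfLinearIndependentOfCardEqFinrank'
    e (Module.End.eigenvectors_linearIndependent' _ ev hev e he) (by simp)
  have hsq : ∀ i, √(ev i) ^ 2 = ev i := fun i => Real.sq_sqrt (hev0 i).le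
  have hG : ContDiff ℝ 3 (gradient W) := ContDiff.gradient (n := 3) hW
  obtain ⟨z, μ, hz, hμ, hvec, K, μp, hK, hμp, hbound⟩ :=
    exists_expansion_of_tendsto_equilibrium (G := gradient W) (u := u) (a := a) hu b
      (ν := fun i => √(ev i))
      (fun i j hij => hev ((Real.sqrt_inj (hev0 i).le (hev0 j).le).1 hij))
      (fun i => Real.sqrt_pos.2 (hev0 i))
      (fun i => by
        rw [hsq]
        simpa [b, hessianAt] using (he i).apply_eq_smul)
      (hG.of_le (by norm_num)) hWa hua hne
  have hcont : ∀ s, 0 < s → ContinuousAt u s := fun s hs => (hu s hs).1.continuousAt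
  refine ⟨z, μ, hz, hμ, hvec, K, μp, fun s => u s - a - (K * Real.exp (-μ * s)) • z, hK, hμp,
    ?_, fun s _ => by simp, ?_, ?_⟩
  · intro n hn
    have hreg : ContDiffOn ℝ (n + 1) u (Ioi 0) := by
      -- For `n = 0` the gradient has no order `n - 1`; the standing `C⁴` hypothesis suffices.
      cases n with
      | zero => exact (contDiffOn_solution hu (n := 0) (hG.of_le (by norm_num))).of_le (by norm_num)
      | succ n =>
        refine (contDiffOn_solution hu (ContDiff.gradient hn)).of_le ?_
        norm_cast
    refine (hreg.sub contDiffOn_const).sub (ContDiff.contDiffOn ?_)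
    fun_prop
  · intro s₀ hs₀
    -- Halving `s₀` includes the endpoint `s₀` in an open half-line while staying away from `0`.
    obtain ⟨Kp, hKp, hle⟩ := hbound (s₀ / 2) (by positivity) fun S _ => by
      refine (isCompact_Icc.image_of_continuousOn (s := Icc (s₀ / 2) S) fun s hs =>
        (hcont s ?_).continuousWithinAt).isBounded.subset (image_mono Ioc_subset_Icc_self)
      linarith [hs.1]
    exact ⟨Kp, hKp, fun s hs => hle s (by linarith)⟩
  · intro hb
    exact hbound 0 le_rfl fun S _ => hb.subset (image_mono Ioc_subset_Ioi_self)

theorem mainTheorem8 (m : ℕ) (W : EuclideanSpace ℝ (Fin m) → ℝ) (hW : ContDiff ℝ 4 W)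
    (A : Finset (EuclideanSpace ℝ (Fin m))) (hA : 2 ≤ A.card)
    (hzero : ∀ a ∈ A, W a = 0) (hpos : ∀ x, x ∉ A → 0 < W x)
    (a : EuclideanSpace ℝ (Fin m)) (ha : a ∈ A) (hH2 : HasDistinctPosEigenvalues W a) :
    (∀ u : ℝ → EuclideanSpace ℝ (Fin m), IsNewtonSolutionOn W u (Ioi 0) →
      Tendsto u atTop (𝓝 a) → (∃ s, 0 < s ∧ u s ≠ a) →
      ∃ (z : EuclideanSpace ℝ (Fin m)) (μ : ℝ),
        Tendsto (fun s => ‖u s - a‖⁻¹ • (u s - a)) atTop (𝓝 z) ∧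
        0 < μ ∧ Module.End.HasEigenvector (hessianAt W a).toLinearMap (μ ^ 2) z ∧
        ∃ (K μp : ℝ) (w : ℝ → EuclideanSpace ℝ (Fin m)), 0 < K ∧ μ < μp ∧
          (∀ n : ℕ, ContDiff ℝ n W → ContDiffOn ℝ (n + 1) w (Ioi 0)) ∧
          (∀ s, 0 < s → u s - a = (K * Real.exp (-μ * s)) • z + w s) ∧
          (∀ s₀, 0 < s₀ → ∃ Kp, 0 < Kp ∧ ∀ s, s₀ ≤ s → ∀ k ≤ 3,
            ‖iteratedDeriv k w s‖ ≤ Kp * Real.exp (-μp * s)) ∧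
          (Bornology.IsBounded (u '' Ioi 0) → ∃ Kp, 0 < Kp ∧ ∀ s, 0 < s → ∀ k ≤ 3,
            ‖iteratedDeriv k w s‖ ≤ Kp * Real.exp (-μp * s))) ∧
    (∀ u : ℝ → EuclideanSpace ℝ (Fin m), IsNewtonSolutionOn W u (Iio 0) →
      Tendsto u atBot (𝓝 a) → (∃ s, s < 0 ∧ u s ≠ a) →
      ∃ (z : EuclideanSpace ℝ (Fin m)) (μ : ℝ),
        Tendsto (fun s => ‖u s - a‖⁻¹ • (u s - a)) atBot (𝓝 z) ∧
        0 < μ ∧ Module.End.HasEigenvector (hessianAt W a).toLinearMap (μ ^ 2) z ∧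
        ∃ (K μp : ℝ) (w : ℝ → EuclideanSpace ℝ (Fin m)), 0 < K ∧ μ < μp ∧
          (∀ n : ℕ, ContDiff ℝ n W → ContDiffOn ℝ (n + 1) w (Iio 0)) ∧
          (∀ s, s < 0 → u s - a = (K * Real.exp (μ * s)) • z + w s) ∧
          (∀ s₀, s₀ < 0 → ∃ Kp, 0 < Kp ∧ ∀ s, s ≤ s₀ → ∀ k ≤ 3,
            ‖iteratedDeriv k w s‖ ≤ Kp * Real.exp (μp * s)) ∧
          (Bornology.IsBounded (u '' Iio 0) → ∃ Kp, 0 < Kp ∧ ∀ s, s < 0 → ∀ k ≤ 3,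
            ‖iteratedDeriv k w s‖ ≤ Kp * Real.exp (μp * s))) := by
  have hWa : gradient W a = 0 := by
    have hmin : IsLocalMin W a := Eventually.of_forall fun x => by
      rw [hzero a ha]
      by_cases hx : x ∈ A
      · exact (hzero x hx).ge
      · exact (hpos x hx).le
    rw [gradient, hmin.fderiv_eq_zero, map_zero]
  refine ⟨newton_expansion_atTop hW hWa hH2, fun u hu hua ⟨s₁, hs₁, hne⟩ => ?_⟩
  -- The equation is invariant under `s ↦ -s`.
  have hderiv : deriv (fun s => u (-s)) = fun s => -deriv u (-s) := funext fun s =>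
    deriv_comp_neg u s
  have hu' : IsNewtonSolutionOn W (fun s => u (-s)) (Ioi 0) := by
    intro s hs
    obtain ⟨h1, h2⟩ := hu (-s) (neg_lt_zero.2 (mem_Ioi.1 hs))
    refine ⟨(h1.hasDerivAt.scomp s (hasDerivAt_neg s)).differentiableAt, ?_⟩
    rw [hderiv]
    exact (h2.scomp s (hasDerivAt_neg s)).neg.congr_deriv (by simp)
  obtain ⟨z, μ, hz, hμ, hvec, K, μp, w, hK, hμp, hreg, heq, hloc, hglob⟩ :=
    newton_expansion_atTop hW hWa hH2 (fun s => u (-s)) hu' (hua.comp tendsto_neg_atTop_atBot)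
      ⟨-s₁, by linarith, by simpa using hne⟩
  have hiter : ∀ k s, ‖iteratedDeriv k (fun s => w (-s)) s‖ = ‖iteratedDeriv k w (-s)‖ := by
    intro k s
    rw [iteratedDeriv_comp_neg, norm_smul, norm_pow, norm_neg, norm_one, one_pow, one_mul]
  refine ⟨z, μ, ?_, hμ, hvec, K, μp, fun s => w (-s), hK, hμp, ?_, ?_, ?_, ?_⟩
  · simpa [Function.comp_def] using hz.comp tendsto_neg_atBot_atTop
  · intro n hn
    exact (hreg n hn).comp contDiff_neg.contDiffOn fun s hs =>
      mem_Ioi.2 (neg_pos.2 (mem_Iio.1 hs))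
  · intro s hs
    simpa using heq (-s) (by linarith)
  · intro s₀ hs₀
    obtain ⟨Kp, hKp, hle⟩ := hloc (-s₀) (by linarith)
    refine ⟨Kp, hKp, fun s hs k hk => ?_⟩
    rw [hiter]
    simpa using hle (-s) (by linarith) k hk
  · intro hb
    obtain ⟨Kp, hKp, hle⟩ := hglob (hb.subset (by
      rintro _ ⟨s, hs, rfl⟩
      exact ⟨-s, mem_Iio.2 (neg_lt_zero.2 (mem_Ioi.1 hs)), rfl⟩))
    refine ⟨Kp, hKp, fun s hs k hk => ?_⟩
    rw [hiter]
    simpa using hle (-s) (by linarith) k hk
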